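/- **Theorem (Lower bound on average contextual regret).** Let $n=n_{\mathcal X}$, $m=n_{\mathcal U}$ and $L_C>0$. There is a constant $\nu>0$, depending only on $L_C,n,m$, with the following property. Let $\mathcal X\subset\mathbb R^{n}$ and $\mathcal U\subset\mathbb R^{m}$ be convex, compact sets with strictly positive diameters, such that $\mathcal X$ contains a hypercube (in any position) of side length $\mathrm{diam}(\mathcal X)/\sqrt n$ (for example, $\mathcal X$ is itself a hypercube, or a Euclidean ball), and $\mathcal U$ contains a closed ball of radius $r>0$. Let $T\ge1$ be an integer and $\xi=\mathrm{diam}(\mathcal X)/(\sqrt n\,T^{1/n})$. A *problem instance* (identity context map, no initial data) consists of an initial state $x_0\in\mathcal X$, dynamics $F:\mathcal X\times\mathcal U\to\mathcal X$ and a differentiable cost $C:\mathbb R^{n+m}\to\mathbb R$ whose gradient is $L_C$-Lipschitz and satisfies $\|\nabla C\|\le L_C\,\mathrm{diam}(\mathcal X\times\mathcal U)$ on $\mathcal X\times\mathcal U$. A *control algorithm* $\mathscr A$ (which may depend on $\mathcal X,\mathcal U,L_C,T$) chooses at each time $t=0,1,\dots$ a control $u_t\in\mathcal U$ as a function of the current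 state $x_t$ and the past data $(x_i,u_i,C(x_i,u_i),\nabla C(x_i,u_i))_{i<t}$; then $x_{t+1}=F(x_t,u_t)$. Its regret at time $t$ is $\rho_t=C(x_t,u_t)-\min_{u\in\mathcal U}C(x_t,u)$, and its average regret over $T$ steps is $R_T=\frac1T\sum_{t=0}^{T-1}\rho_t$. Then for every control algorithm $\mathscr A$ there is a problem instance such that, when $\mathscr A$ is run on it, 1. the instance is $(\xi,T)$-resisting to $\mathscr A$: $\|x_{t+1}-x_i\|>\xi$ for all $0\le i\le t<T-1$, and $C(x_t,u_t)=0$, $\nabla C(x_t,u_t)=0$ for all $0\le t\le T-1$; 2. on this same instance, $R_T\ \ge\ \nu\,\min(\mathrm{diam}(\mathcal X),r)^2\;T^{-2/(n+m)}$. In particular, if $\mathrm{diam}(\mathcal X)\ge1$ and $r\ge1$, then $R_T\ge\nu\,T^{-2/(n_{\mathcal X}+n_{\mathcal U})}$ with $\nu$ depending only on $L_C$, $n_{\mathcal X}$, $n_{\mathcal U}$. -/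

import Mathlib

/-- Euclidean space of dimension `n`; states are in `Euc n`, controls in `Euc m`. -/
abbrev Euc (n : ℕ) := EuclideanSpace ℝ (Fin n)

/-- State-control pairs, with the Euclidean norm of dimension `n + m`. -/
abbrev Joint (n m : ℕ) := WithLp 2 (Euc n × Euc m)

/-- The set `X × U` inside the Euclidean space of state-control pairs. -/
def jointSet {n m : ℕ} (X : Set (Euc n)) (U : Set (Euc m)) : Set (Joint n m) :=
  {s | s.fst ∈ X ∧ s.snd ∈ U}

/-- `X` contains a closed hypercube (in any position) of side length `a`. -/
def ContainsHypercube {n : ℕ} (X : Set (Euc n)) (a : ℝ) : Prop :=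
  ∃ (p : Euc n) (b : OrthonormalBasis (Fin n) ℝ (Euc n)),
    ∀ c : Fin n → ℝ, (∀ i, c i ∈ Set.Icc 0 a) → p + ∑ i, c i • b i ∈ X

/-- What is recorded at one past time step: the state (which is the context, as the context map
is the identity), the applied control, and the first-order information returned by the oracle. -/
structure Observation (n m : ℕ) where
  state : Euc n
  control : Euc m
  cost : ℝ
  grad : Joint n m

/-- A control algorithm: it picks an admissible control from the list of past observations
(oldest first) and the current state, and from nothing else about the dynamics and the cost. -/
structure ControlAlgorithm {n m : ℕ} (X : Set (Euc n)) (U : Set (Euc m)) where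
  decide : List (Observation n m) → Euc n → Euc m
  decide_mem : ∀ h, ∀ x ∈ X, decide h x ∈ U

/-- A problem instance on `X` and `U` with identity context map and no initial data: an initial
state, dynamics `F : X × U → X`, and a one-step cost `C` with `L`-Lipschitz gradient whose norm
is at most `G` on `X × U`. The cost is the restriction to `X × U` of a function on the whole
Euclidean space, with the Lipschitz bound on the whole space. -/
structure ProblemInstance {n m : ℕ} (X : Set (Euc n)) (U : Set (Euc m)) (L G : ℝ) where
  x₀ : Euc n
  F : Euc n → Euc m → Euc n
  C : Joint n m → ℝ
  x₀_mem : x₀ ∈ X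
  F_mem : ∀ x ∈ X, ∀ u ∈ U, F x u ∈ X
  differentiable : Differentiable ℝ C
  grad_lipschitz : ∀ s s' : Joint n m, ‖gradient C s - gradient C s'‖ ≤ L * ‖s - s'‖
  grad_bound : ∀ s ∈ jointSet X U, ‖gradient C s‖ ≤ G

namespace ProblemInstance

variable {n m : ℕ} {X : Set (Euc n)} {U : Set (Euc m)} {L G : ℝ}

/-- The past observations and the current state at time `t`, when the algorithm `A` runs on the
instance `P` starting without data. -/
noncomputable def run (P : ProblemInstance X U L G) (A : ControlAlgorithm X U) :
    ℕ → List (Observation n m) × Euc n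
  | 0 => ([], P.x₀)
  | t + 1 =>
    let h := (run P A t).1
    let x := (run P A t).2
    let u := A.decide h x
    (h ++ [⟨x, u, P.C (WithLp.toLp 2 (x, u)), gradient P.C (WithLp.toLp 2 (x, u))⟩], P.F x u)

/-- The state `x_t`. -/
noncomputable def state (P : ProblemInstance X U L G) (A : ControlAlgorithm X U) (t : ℕ) :
    Euc n :=
  (P.run A t).2

/-- The control `u_t` chosen by the algorithm. -/
noncomputable def control (P : ProblemInstance X U L G) (A : ControlAlgorithm X U) (t : ℕ) :
    Euc m :=
  A.decide (P.run A t).1 (P.run A t).2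

/-- The pair `(x_t, u_t)` at which the oracle is queried. -/
noncomputable def query (P : ProblemInstance X U L G) (A : ControlAlgorithm X U) (t : ℕ) :
    Joint n m :=
  WithLp.toLp 2 (P.state A t, P.control A t)

/-- The regret `ρ_t = C(x_t, u_t) - min_{u ∈ U} C(x_t, u)`. -/
noncomputable def regret (P : ProblemInstance X U L G) (A : ControlAlgorithm X U) (t : ℕ) : ℝ :=
  P.C (P.query A t) - sInf ((fun u => P.C (WithLp.toLp 2 (P.state A t, u))) '' U)

/-- The average regret over the `T` control steps `0, …, T - 1`. -/
noncomputable def avgRegret (P : ProblemInstance X U L G) (A : ControlAlgorithm X U) (T : ℕ) :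
    ℝ :=
  (1 / (T : ℝ)) * ∑ t ∈ Finset.range T, P.regret A t

/-- The `(ξ, T)`-resisting property over the `T` control steps `0, …, T - 1`. -/
def IsResisting (P : ProblemInstance X U L G) (A : ControlAlgorithm X U) (ξ : ℝ) (T : ℕ) :
    Prop :=
  (∀ t, t + 1 < T → ∀ i ≤ t, ξ < ‖P.state A (t + 1) - P.state A i‖) ∧
  (∀ t < T, P.C (P.query A t) = 0 ∧ gradient P.C (P.query A t) = 0)

end ProblemInstance

/-! An adversary fixes the trajectory beforehand: `T` grid states in the hypercube, pairwise more
than `ξ` apart. If the oracle always answers zero, the controls are then determined, so the cost may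
be built afterwards, provided that it vanishes to first order at every query. The cost is minus a
sum of `C^{1,1}` bumps of radius `R`. A bump at `(x s, v)` misses every query if `v` is `R`-far from
the controls used at states within `R` of `x s`. By volume there are at most `(1 + 2R/ξ)^n` such
states, and such a `v` exists when `(1 + 2R/ξ)^n R^m < r^m`. This permits `R` of order
`T^(-1/(n+m))` (`packing_balance`). Centring bumps only on an `R/2`-net of the states keeps their
overlap, hence the Lipschitz constant, independent of `T`, while each state still sees a well of
depth of order `R^2` (`exists_cost`). So every single step has regret of order `R^2`. -/

section Bumps

/-! ### Bump functions with Lipschitz gradient -/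

variable {E : Type*} [NormedAddCommGroup E]

theorem hasDerivAt_max_zero_sq (y : ℝ) :
    HasDerivAt (fun y : ℝ => max y 0 ^ 2) (2 * max y 0) y := by
  rcases lt_trichotomy y 0 with hy | rfl | hy
  · rw [max_eq_right hy.le, mul_zero]
    refine (hasDerivAt_const y (0 : ℝ)).congr_of_eventuallyEq ?_
    filter_upwards [gt_mem_nhds hy] with z hz
    simp [max_eq_right hz.le]
  · rw [hasDerivAt_iff_isLittleO]
    refine Asymptotics.IsBigO.trans_isLittleO (g := fun y : ℝ => y ^ 2) ?_ ?_
    · refine Asymptotics.IsBigO.of_bound 1 (Filter.Eventually.of_forall fun z => ?_)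
      rcases le_total z 0 with hz | hz
      · simp [max_eq_right hz, sq_nonneg]
      · simp [max_eq_left hz]
    · simpa using Asymptotics.isLittleO_pow_id (𝕜 := ℝ) (n := 2) (by norm_num)
  · rw [max_eq_left hy.le]
    have h := (hasDerivAt_id y).pow 2
    refine (h.congr_of_eventuallyEq ?_).congr_deriv (by simp)
    filter_upwards [lt_mem_nhds hy] with z hz
    simp [max_eq_left hz.le]

/-- A `C^{1,1}` bump centred at `z` and supported in the closed ball of radius `R`. -/
noncomputable def bump (R : ℝ) (z s : E) : ℝ := max (R ^ 2 - ‖s - z‖ ^ 2) 0 ^ 2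

/-- The gradient of `bump R z`. -/
noncomputable def bumpGrad [InnerProductSpace ℝ E] (R : ℝ) (z s : E) : E :=
  (-4 * max (R ^ 2 - ‖s - z‖ ^ 2) 0) • (s - z)

theorem hasGradientAt_bump [InnerProductSpace ℝ E] [CompleteSpace E] (R : ℝ) (z s : E) :
    HasGradientAt (bump R z) (bumpGrad R z s) s := by
  rw [hasGradientAt_iff_hasFDerivAt]
  have h1 : HasFDerivAt (fun s : E => R ^ 2 - ‖s - z‖ ^ 2)
      (-(2 • (innerSL ℝ (s - z)).comp (ContinuousLinearMap.id ℝ E))) s :=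
    (((hasFDerivAt_id s).sub_const z).norm_sq).const_sub (R ^ 2)
  refine ((hasDerivAt_max_zero_sq _).comp_hasFDerivAt s h1).congr_fderiv ?_
  ext v
  simp [bumpGrad]
  ring

theorem bump_nonneg (R : ℝ) (z s : E) : 0 ≤ bump R z s := sq_nonneg _

theorem bump_eq_zero {R : ℝ} (hR : 0 ≤ R) {z s : E} (h : R ≤ ‖s - z‖) : bump R z s = 0 := by
  have : R ^ 2 ≤ ‖s - z‖ ^ 2 := by gcongr
  simp [bump, max_eq_right (sub_nonpos.2 this)]

theorem bumpGrad_eq_zero [InnerProductSpace ℝ E] {R : ℝ} (hR : 0 ≤ R) {z s : E}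
    (h : R ≤ ‖s - z‖) :
    bumpGrad R z s = 0 := by
  have : R ^ 2 ≤ ‖s - z‖ ^ 2 := by gcongr
  simp [bumpGrad, max_eq_right (sub_nonpos.2 this)]

theorem bump_le (R : ℝ) (z s : E) : bump R z s ≤ (R ^ 2) ^ 2 := by
  unfold bump
  have : max (R ^ 2 - ‖s - z‖ ^ 2) 0 ≤ R ^ 2 :=
    max_le (by nlinarith [sq_nonneg ‖s - z‖]) (sq_nonneg R)
  gcongr

theorem le_bump {R : ℝ} {z s : E} (h : ‖s - z‖ ≤ R / 2) :
    (3 / 4 * R ^ 2) ^ 2 ≤ bump R z s := by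
  unfold bump
  have h2 : ‖s - z‖ ^ 2 ≤ (R / 2) ^ 2 := by gcongr
  have : 3 / 4 * R ^ 2 ≤ max (R ^ 2 - ‖s - z‖ ^ 2) 0 := le_max_of_le_left (by nlinarith)
  gcongr

theorem norm_bumpGrad_sub_le [InnerProductSpace ℝ E] {R : ℝ} (hR : 0 ≤ R) (z s s' : E) :
    ‖bumpGrad R z s - bumpGrad R z s'‖ ≤ 12 * R ^ 2 * ‖s - s'‖ := by
  wlog hle : ‖s - z‖ ≤ ‖s' - z‖ generalizing s s'
  · rw [norm_sub_rev, norm_sub_rev s s']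
    exact this s' s (le_of_not_ge hle)
  rcases le_or_gt R ‖s - z‖ with hs | hs
  · rw [bumpGrad_eq_zero hR hs, bumpGrad_eq_zero hR (hs.trans hle)]
    simp; positivity
  have hd : ‖s' - z‖ - ‖s - z‖ ≤ ‖s - s'‖ := by
    have := norm_sub_norm_le (s' - z) (s - z)
    rwa [sub_sub_sub_cancel_right, norm_sub_rev s' s] at this
  have h0 := norm_nonneg (s - z)
  -- The scalar difference multiplies `s - z`, the shorter vector, whose norm is below `R`; the
  -- constant is `12 = 4 + 4 * 2`.
  have heq : bumpGrad R z s - bumpGrad R z s' =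
      (-4 * max (R ^ 2 - ‖s' - z‖ ^ 2) 0) • (s - s') +
      (-4 * (max (R ^ 2 - ‖s - z‖ ^ 2) 0 - max (R ^ 2 - ‖s' - z‖ ^ 2) 0)) • (s - z) := by
    unfold bumpGrad
    module
  set v := ‖s - z‖
  set w := ‖s' - z‖
  set d := ‖s - s'‖
  have hw0 : 0 ≤ max (R ^ 2 - w ^ 2) 0 := le_max_right _ _
  have hw1 : max (R ^ 2 - w ^ 2) 0 ≤ R ^ 2 :=
    max_le (by nlinarith [sq_nonneg w]) (sq_nonneg R)
  have hv : max (R ^ 2 - v ^ 2) 0 = R ^ 2 - v ^ 2 := max_eq_left (by nlinarith)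
  have hdiff : |max (R ^ 2 - v ^ 2) 0 - max (R ^ 2 - w ^ 2) 0| ≤ 2 * R * d := by
    rw [abs_le, hv]
    rcases le_total w R with hw | hw
    · rw [max_eq_left (by nlinarith)]
      constructor <;> nlinarith
    · rw [max_eq_right (by nlinarith)]
      constructor <;> nlinarith
  have hd0 : 0 ≤ d := norm_nonneg _
  calc ‖bumpGrad R z s - bumpGrad R z s'‖
      ≤ 4 * max (R ^ 2 - w ^ 2) 0 * d
        + 4 * |max (R ^ 2 - v ^ 2) 0 - max (R ^ 2 - w ^ 2) 0| * v := by
        rw [heq]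
        refine (norm_add_le _ _).trans (le_of_eq ?_)
        rw [norm_smul, norm_smul, norm_mul, norm_mul, Real.norm_of_nonneg hw0, Real.norm_eq_abs,
          Real.norm_eq_abs]
        norm_num [v, d]
    _ ≤ 4 * R ^ 2 * d + 4 * (2 * R * d) * R := by gcongr
    _ = 12 * R ^ 2 * d := by ring

end Bumps

/-! ### Bounded overlap and nets -/

/-- Only the at most `2M` indices active at `s` or `s'` contribute, so the size of `S` does not
enter. -/
theorem norm_sum_sub_sum_le_of_overlap {ι E F : Type*} [SeminormedAddCommGroup E]
    [NormedAddCommGroup F] (S : Finset ι) (f : ι → E → F) {K M : ℝ} (hK : 0 ≤ K)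
    (hf : ∀ i ∈ S, ∀ s s', ‖f i s - f i s'‖ ≤ K * ‖s - s'‖)
    (hM : ∀ s, ∀ S' ⊆ S, (∀ i ∈ S', f i s ≠ 0) → (S'.card : ℝ) ≤ M) (s s' : E) :
    ‖∑ i ∈ S, f i s - ∑ i ∈ S, f i s'‖ ≤ 2 * M * K * ‖s - s'‖ := by
  classical
  set S₁ := S.filter fun i => f i s ≠ 0
  set S₂ := S.filter fun i => f i s' ≠ 0
  have h1 : (S₁.card : ℝ) ≤ M := hM s _ (Finset.filter_subset _ _) (by simp [S₁])
  have h2 : (S₂.card : ℝ) ≤ M := hM s' _ (Finset.filter_subset _ _) (by simp [S₂])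
  have hcard : ((S₁ ∪ S₂).card : ℝ) ≤ 2 * M := by
    have : ((S₁ ∪ S₂).card : ℝ) ≤ S₁.card + S₂.card := by
      exact_mod_cast Finset.card_union_le _ _
    linarith
  have hsub : S₁ ∪ S₂ ⊆ S :=
    Finset.union_subset (Finset.filter_subset _ _) (Finset.filter_subset _ _)
  rw [← Finset.sum_sub_distrib, ← Finset.sum_subset hsub]
  · calc ‖∑ i ∈ S₁ ∪ S₂, (f i s - f i s')‖
        ≤ ∑ i ∈ S₁ ∪ S₂, K * ‖s - s'‖ :=
          norm_sum_le_of_le _ fun i hi => hf i (hsub hi) s s'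
      _ = (S₁ ∪ S₂).card * (K * ‖s - s'‖) := by simp
      _ ≤ 2 * M * (K * ‖s - s'‖) := by gcongr
      _ = 2 * M * K * ‖s - s'‖ := by ring
  · intro i hi hi'
    simp only [S₁, S₂, Finset.mem_union, Finset.mem_filter, not_or, not_and, not_not] at hi'
    rw [hi'.1 hi, hi'.2 hi, sub_zero]

theorem exists_separated_net {ι E : Type*} [PseudoMetricSpace E] (x : ι → E) (δ : ℝ)
    (I : Finset ι) :
    ∃ S ⊆ I, (∀ i ∈ S, ∀ j ∈ S, i ≠ j → δ ≤ dist (x i) (x j)) ∧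
      ∀ i ∈ I, i ∈ S ∨ ∃ j ∈ S, dist (x i) (x j) < δ := by
  classical
  induction I using Finset.induction_on with
  | empty => exact ⟨∅, by simp⟩
  | insert a I ha ih =>
    obtain ⟨S, hS, hsep, hnet⟩ := ih
    by_cases h : ∃ j ∈ S, dist (x a) (x j) < δ
    · refine ⟨S, hS.trans (Finset.subset_insert _ _), hsep, fun i hi => ?_⟩
      rcases Finset.mem_insert.1 hi with rfl | hi
      · exact Or.inr h
      · exact hnet i hi
    · push Not at h
      refine ⟨insert a S, Finset.insert_subset_insert _ hS, ?_, fun i hi => ?_⟩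
      · intro i hi j hj hij
        rcases Finset.mem_insert.1 hi with rfl | hi' <;>
          rcases Finset.mem_insert.1 hj with rfl | hj'
        · exact absurd rfl hij
        · exact h j hj'
        · rw [dist_comm]; exact h i hi'
        · exact hsep i hi' j hj' hij
      · rcases Finset.mem_insert.1 hi with rfl | hi
        · exact Or.inl (Finset.mem_insert_self _ _)
        · rcases hnet i hi with h' | ⟨j, hj, h'⟩
          · exact Or.inl (Finset.mem_insert_of_mem h')
          · exact Or.inr ⟨j, Finset.mem_insert_of_mem hj, h'⟩

/-! ### Packing and covering by volume -/

section Volume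

open MeasureTheory Module Metric

variable {E : Type*} [NormedAddCommGroup E] [NormedSpace ℝ E] [FiniteDimensional ℝ E]

/-- The balls of radius `δ/2` about the points are disjoint and lie in a ball of radius `R + δ/2`.
-/
theorem card_le_of_separated_of_dist_le {ι : Type*} (I : Finset ι) (x : ι → E) (p : E) {δ R : ℝ}
    (hδ : 0 < δ) (hR : 0 < R) (hsep : ∀ i ∈ I, ∀ j ∈ I, i ≠ j → δ ≤ dist (x i) (x j))
    (hball : ∀ i ∈ I, dist (x i) p ≤ R) :
    (I.card : ℝ) ≤ (1 + 2 * R / δ) ^ finrank ℝ E := by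
  borelize E
  let μ : Measure E := Measure.addHaar
  have hdisj : (I : Set ι).PairwiseDisjoint fun i => ball (x i) (δ / 2) := by
    intro i hi j hj hij
    exact ball_disjoint_ball (by linarith [hsep i hi j hj hij])
  have hsub : (⋃ i ∈ I, ball (x i) (δ / 2)) ⊆ ball p (R + δ / 2) := by
    refine Set.iUnion₂_subset fun i hi => ball_subset_ball' ?_
    linarith [hball i hi]
  have hμ : (I.card : ENNReal) * (ENNReal.ofReal ((δ / 2) ^ finrank ℝ E) * μ (ball 0 1)) ≤
      ENNReal.ofReal ((R + δ / 2) ^ finrank ℝ E) * μ (ball 0 1) := by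
    have := measure_mono (μ := μ) hsub
    rw [measure_biUnion_finset hdisj fun i _ => measurableSet_ball] at this
    simpa [Measure.addHaar_ball_of_pos μ _ (half_pos hδ),
      Measure.addHaar_ball_of_pos μ p (by positivity : 0 < R + δ / 2)] using this
  rw [← mul_assoc, ENNReal.mul_le_mul_iff_left (measure_ball_pos μ 0 one_pos).ne'
    measure_ball_lt_top.ne, ← ENNReal.ofReal_natCast, ← ENNReal.ofReal_mul (by positivity),
    ENNReal.ofReal_le_ofReal_iff (by positivity), ← le_div_iff₀ (by positivity), ← div_pow] at hμ
  have heq : 1 + 2 * R / δ = (R + δ / 2) / (δ / 2) := by field_simp; ring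
  rwa [heq]

/-- Otherwise the `R`-balls about the `u i` would cover a ball of radius `r`, against the volume
count. -/
theorem exists_mem_closedBall_forall_le_dist {ι : Type*} (I : Finset ι) (u : ι → E) (c : E)
    {r R : ℝ} (hr : 0 < r) (hR : 0 < R)
    (hcard : (I.card : ℝ) * R ^ finrank ℝ E < r ^ finrank ℝ E) :
    ∃ v ∈ closedBall c r, ∀ i ∈ I, R ≤ dist (u i) v := by
  by_contra! h
  borelize E
  let μ : Measure E := Measure.addHaar
  have hsub : ball c r ⊆ ⋃ i ∈ I, ball (u i) R := by
    intro v hv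
    obtain ⟨i, hi, hd⟩ := h v (ball_subset_closedBall hv)
    exact Set.mem_iUnion₂.2 ⟨i, hi, by rwa [mem_ball, dist_comm]⟩
  have hμ : ENNReal.ofReal (r ^ finrank ℝ E) * μ (ball 0 1) ≤
      (I.card : ENNReal) * (ENNReal.ofReal (R ^ finrank ℝ E) * μ (ball 0 1)) := by
    have := (measure_mono (μ := μ) hsub).trans (measure_biUnion_finset_le _ _)
    simpa [Measure.addHaar_ball_of_pos μ _ hr, Measure.addHaar_ball_of_pos μ _ hR] using this
  rw [← mul_assoc, ENNReal.mul_le_mul_iff_left (measure_ball_pos μ 0 one_pos).ne'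
    measure_ball_lt_top.ne, ← ENNReal.ofReal_natCast, ← ENNReal.ofReal_mul (by positivity),
    ENNReal.ofReal_le_ofReal_iff (by positivity)] at hμ
  exact absurd hμ (not_le.2 hcard)

end Volume

/-! ### The prescribed states -/

theorem ContainsHypercube.exists_separated {n : ℕ} (hn : 0 < n) {X : Set (Euc n)} {a : ℝ}
    (ha : 0 < a) (hX : ContainsHypercube X a) {T : ℕ} (hT : 0 < T) :
    ∃ x : ℕ → Euc n, (∀ t, x t ∈ X) ∧
      ∀ i < T, ∀ j < T, i ≠ j → a / (T : ℝ) ^ (1 / (n : ℝ)) < ‖x i - x j‖ := by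
  obtain ⟨p, b, hp⟩ := hX
  set τ : ℝ := (T : ℝ) ^ (1 / (n : ℝ)) with hτ
  have hT0 : (0 : ℝ) < T := by exact_mod_cast hT
  have hτ0 : 0 < τ := Real.rpow_pos_of_pos hT0 _
  have hτT : τ ^ n = T := by
    rw [hτ, one_div, Real.rpow_inv_natCast_pow hT0.le hn.ne']
  set k := ⌈τ⌉₊ with hk
  have hk0 : 0 < k := Nat.ceil_pos.2 hτ0
  have hkτ : (k : ℝ) - 1 < τ := by linarith [Nat.ceil_lt_add_one hτ0.le]
  have hTk : T ≤ k ^ n := by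
    have : (T : ℝ) ≤ (k : ℝ) ^ n := by
      rw [← hτT]; gcongr; exact Nat.le_ceil τ
    exact_mod_cast this
  have hcard : Fintype.card (Fin T) ≤ Fintype.card (Fin n → Fin k) := by simpa using hTk
  obtain ⟨e⟩ := Function.Embedding.nonempty_of_card_le hcard
  -- With `k = ⌈τ⌉` grid points per axis, both ends included, the spacing strictly exceeds `a / τ`
  -- because `k - 1 < τ`. If `k = 1`, division by zero gives `δ = 0`, which is harmless: there is
  -- only one point.
  let δ : ℝ := a / ((k : ℝ) - 1)
  let y : Fin T → Euc n := fun t => p + ∑ i, ((e t i : ℕ) * δ : ℝ) • b i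
  have hk1 : (0 : ℝ) ≤ (k : ℝ) - 1 := by
    have : (1 : ℝ) ≤ k := by exact_mod_cast hk0
    linarith
  have hδ0 : 0 ≤ δ := div_nonneg ha.le hk1
  have hy : ∀ t, y t ∈ X := by
    refine fun t => hp _ fun i => ⟨by positivity, ?_⟩
    have hle : ((e t i : ℕ) : ℝ) ≤ (k : ℝ) - 1 := by
      have : (e t i : ℕ) + 1 ≤ k := (e t i).2
      have : ((e t i : ℕ) : ℝ) + 1 ≤ k := by exact_mod_cast this
      linarith
    calc ((e t i : ℕ) : ℝ) * δ ≤ ((k : ℝ) - 1) * δ := by gcongr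
      _ ≤ a := by
        rcases hk1.eq_or_lt with h | h
        · rw [← h, zero_mul]; exact ha.le
        · rw [mul_div_cancel₀ _ h.ne']
  have hsep : ∀ s t, s ≠ t → a / τ < ‖y s - y t‖ := by
    intro s t hst
    obtain ⟨i, hi⟩ := Function.ne_iff.1 (e.injective.ne hst)
    have hi' : (e s i : ℕ) ≠ (e t i : ℕ) := fun h => hi (Fin.ext h)
    have hk2 : (0 : ℝ) < (k : ℝ) - 1 := by
      have h1 := (e s i).2
      have h2 := (e t i).2
      have : 1 < k := by omega
      have : (1 : ℝ) < k := by exact_mod_cast this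
      linarith
    have hinner : inner ℝ (b i) (y s - y t) = (((e s i : ℕ) : ℝ) - (e t i : ℕ)) * δ := by
      have : y s - y t = ∑ i, ((((e s i : ℕ) : ℝ) - (e t i : ℕ)) * δ) • b i := by
        simp only [y, add_sub_add_left_eq_sub, ← Finset.sum_sub_distrib, ← sub_smul, sub_mul]
      rw [this, b.orthonormal.inner_right_fintype]
    have h1 : (1 : ℝ) ≤ |((e s i : ℕ) : ℝ) - (e t i : ℕ)| := by
      have : (1 : ℤ) ≤ |((e s i : ℕ) : ℤ) - (e t i : ℕ)| :=
        Int.one_le_abs (sub_ne_zero.2 (by exact_mod_cast hi'))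
      exact_mod_cast this
    calc a / τ < δ := div_lt_div_of_pos_left ha hk2 hkτ
      _ = 1 * δ := (one_mul _).symm
      _ ≤ |((e s i : ℕ) : ℝ) - (e t i : ℕ)| * δ := by gcongr
      _ = ‖inner ℝ (b i) (y s - y t)‖ := by
        rw [hinner, Real.norm_eq_abs, abs_mul, abs_of_nonneg hδ0]
      _ ≤ ‖b i‖ * ‖y s - y t‖ := norm_inner_le_norm _ _
      _ = ‖y s - y t‖ := by rw [b.norm_eq_one, one_mul]
  refine ⟨fun t => if h : t < T then y ⟨t, h⟩ else y ⟨0, hT⟩, fun t => ?_, ?_⟩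
  · dsimp only
    split_ifs <;> exact hy _
  · intro i hi j hj hij
    simp only [hi, hj, dif_pos]
    exact hsep _ _ (by simpa using hij)

/-! ### The cost function -/

theorem exists_cost {n m : ℕ} {L R : ℝ} (hL : 0 < L) (hR : 0 < R) (U : Set (Euc m))
    (x : ℕ → Euc n) (u : ℕ → Euc m) (T : ℕ)
    (hfree : ∀ s < T, ∃ v ∈ U, ∀ t < T, dist (x t) (x s) < R → R ≤ dist (u t) v) :
    ∃ C : Joint n m → ℝ, Differentiable ℝ C ∧
      (∀ s s', ‖gradient C s - gradient C s'‖ ≤ L * ‖s - s'‖) ∧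
      (∀ t < T, C (WithLp.toLp 2 (x t, u t)) = 0 ∧ gradient C (WithLp.toLp 2 (x t, u t)) = 0) ∧
      (∃ B, ∀ s, B ≤ C s) ∧
      ∀ t < T, ∃ v ∈ U, C (WithLp.toLp 2 (x t, v)) ≤ -(3 * L / (128 * 5 ^ n) * R ^ 2) := by
  obtain ⟨S, hST, hsep, hnet⟩ := exists_separated_net x (R / 2) (Finset.range T)
  have hfree' : ∀ s, ∃ v, s < T → v ∈ U ∧ ∀ t < T, dist (x t) (x s) < R → R ≤ dist (u t) v := by
    intro s
    by_cases hs : s < T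
    · obtain ⟨v, hv⟩ := hfree s hs
      exact ⟨v, fun _ => hv⟩
    · exact ⟨0, fun h => absurd h hs⟩
  choose v hv using hfree'
  let z : ℕ → Joint n m := fun s => WithLp.toLp 2 (x s, v s)
  have hST' : ∀ s ∈ S, s < T := fun s hs => Finset.mem_range.1 (hST hs)
  -- Each bump gradient is `12 R^2`-Lipschitz and at most `5^n` bumps are active at a point, so the
  -- sum is `24 * 5^n * R^2`-Lipschitz.
  let κ : ℝ := L / (24 * 5 ^ n * R ^ 2)
  have hκ : 0 < κ := by positivity
  let C : Joint n m → ℝ := fun s => -κ * ∑ i ∈ S, bump R (z i) s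
  have hgrad : ∀ s, HasGradientAt C (-κ • ∑ i ∈ S, bumpGrad R (z i) s) s := by
    intro s
    rw [hasGradientAt_iff_hasFDerivAt, map_smul, map_sum]
    exact (HasFDerivAt.fun_sum fun i _ =>
      hasGradientAt_iff_hasFDerivAt.1 (hasGradientAt_bump R (z i) s)).const_mul (-κ)
  have hfar : ∀ t < T, ∀ i ∈ S, R ≤ ‖(WithLp.toLp 2 (x t, u t) : Joint n m) - z i‖ := by
    intro t ht i hi
    by_cases h : dist (x t) (x i) < R
    · refine ((hv i (hST' i hi)).2 t ht h).trans ?_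
      rw [dist_eq_norm]
      exact WithLp.norm_snd_le _ (WithLp.toLp 2 (x t, u t) - z i)
    · refine (not_lt.1 h).trans ?_
      rw [dist_eq_norm]
      exact WithLp.norm_fst_le _ (WithLp.toLp 2 (x t, u t) - z i)
  refine ⟨C, fun s => (hgrad s).differentiableAt, ?_, ?_, ?_, ?_⟩
  · intro s s'
    have hoverlap : ∀ s, ∀ S' ⊆ S, (∀ i ∈ S', bumpGrad R (z i) s ≠ 0) →
        (S'.card : ℝ) ≤ 5 ^ n := by
      intro s S' hS' hne
      have h := card_le_of_separated_of_dist_le S' x s.fst (half_pos hR) hR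
        (fun i hi j hj => hsep i (hS' hi) j (hS' hj)) fun i hi => by
          by_contra hlt
          refine hne i hi (bumpGrad_eq_zero hR.le ?_)
          refine (not_le.1 hlt).le.trans ?_
          rw [dist_comm, dist_eq_norm]
          exact WithLp.norm_fst_le _ (s - z i)
      have h5 : 1 + 2 * R / (R / 2) = 5 := by field_simp; norm_num
      rwa [h5, finrank_euclideanSpace_fin] at h
    have hsum := norm_sum_sub_sum_le_of_overlap S (fun i => bumpGrad R (z i))
      (by positivity : 0 ≤ 12 * R ^ 2)
      (fun i _ => norm_bumpGrad_sub_le hR.le (z i)) hoverlap s s'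
    rw [(hgrad s).gradient, (hgrad s').gradient, ← smul_sub, norm_smul, norm_neg,
      Real.norm_of_nonneg hκ.le]
    calc κ * ‖∑ i ∈ S, bumpGrad R (z i) s - ∑ i ∈ S, bumpGrad R (z i) s'‖
        ≤ κ * (2 * 5 ^ n * (12 * R ^ 2) * ‖s - s'‖) := by gcongr
      _ = L * ‖s - s'‖ := by simp only [κ]; field_simp; norm_num
  · intro t ht
    constructor
    · simp only [C]
      rw [Finset.sum_eq_zero fun i hi => bump_eq_zero hR.le (hfar t ht i hi), mul_zero]
    · rw [(hgrad _).gradient,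
        Finset.sum_eq_zero fun i hi => bumpGrad_eq_zero hR.le (hfar t ht i hi), smul_zero]
  · refine ⟨-κ * ∑ i ∈ S, (R ^ 2) ^ 2, fun s => ?_⟩
    have : ∑ i ∈ S, bump R (z i) s ≤ ∑ i ∈ S, (R ^ 2) ^ 2 :=
      Finset.sum_le_sum fun i _ => bump_le R (z i) s
    simp only [C]
    nlinarith
  · intro t ht
    obtain ⟨i, hi, hd⟩ : ∃ i ∈ S, dist (x t) (x i) ≤ R / 2 := by
      rcases hnet t (Finset.mem_range.2 ht) with h | ⟨i, hi, h⟩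
      · exact ⟨t, h, by rw [dist_self]; positivity⟩
      · exact ⟨i, hi, h.le⟩
    -- With the control of a nearby net point, the pair differs from the bump centre only in the
    -- state, by at most `R/2`.
    refine ⟨v i, (hv i (hST' i hi)).1, ?_⟩
    have hnorm : ‖(WithLp.toLp 2 (x t, v i) : Joint n m) - z i‖ ≤ R / 2 := by
      refine le_of_sq_le_sq ?_ (by positivity)
      rw [WithLp.prod_norm_sq_eq_of_L2]
      rw [dist_eq_norm] at hd
      have : ‖x t - x i‖ ^ 2 ≤ (R / 2) ^ 2 := by gcongr
      simpa [z] using this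
    have hle : (3 / 4 * R ^ 2) ^ 2 ≤ ∑ j ∈ S, bump R (z j) (WithLp.toLp 2 (x t, v i)) :=
      (le_bump hnorm).trans (Finset.single_le_sum
        (f := fun j => bump R (z j) (WithLp.toLp 2 (x t, v i)))
        (fun j _ => bump_nonneg R (z j) _) hi)
    have hκ' : κ * (3 / 4 * R ^ 2) ^ 2 = 3 * L / (128 * 5 ^ n) * R ^ 2 := by
      simp only [κ]; field_simp; norm_num
    simp only [C]
    rw [← hκ']
    nlinarith

/-! ### The resisting instance -/

/-- The history recorded by the algorithm along the states `x` if all oracle answers vanish. -/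
noncomputable def zeroHistory {n m : ℕ} {X : Set (Euc n)} {U : Set (Euc m)}
    (A : ControlAlgorithm X U) (x : ℕ → Euc n) : ℕ → List (Observation n m)
  | 0 => []
  | t + 1 => zeroHistory A x t ++ [⟨x t, A.decide (zeroHistory A x t) (x t), 0, 0⟩]

theorem isBounded_jointSet {n m : ℕ} {X : Set (Euc n)} {U : Set (Euc m)} (hX : IsCompact X)
    (hU : IsCompact U) : Bornology.IsBounded (jointSet X U) := by
  have h : IsCompact (WithLp.toLp 2 '' (X ×ˢ U) : Set (Joint n m)) :=
    (hX.prod hU).image (WithLp.prod_continuous_toLp 2 _ _)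
  refine h.isBounded.subset fun s hs => ⟨(s.fst, s.snd), ⟨hs.1, hs.2⟩, rfl⟩

/-- Against any algorithm, an instance that visits prescribed distinct states `x 0, …, x (T - 1)`,
answers all queries by zero and has regret of order `R ^ 2` at each step, provided that around each
state there is room in `U` for a control at distance `R` from all the queries. -/
theorem exists_instance {n m : ℕ} {L R : ℝ} (hL : 0 < L) (hR : 0 < R) {X : Set (Euc n)}
    {U : Set (Euc m)} (hX : IsCompact X) (hU : IsCompact U) {T : ℕ} (hT : 0 < T)
    (A : ControlAlgorithm X U) (x : ℕ → Euc n) (hxX : ∀ t, x t ∈ X)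
    (hinj : Set.InjOn x (Set.Iio T))
    (hfree : ∀ u : ℕ → Euc m, ∀ s < T,
      ∃ v ∈ U, ∀ t < T, dist (x t) (x s) < R → R ≤ dist (u t) v) :
    ∃ P : ProblemInstance X U L (L * Metric.diam (jointSet X U)),
      (∀ t < T, P.state A t = x t ∧
        P.C (P.query A t) = 0 ∧ gradient P.C (P.query A t) = 0) ∧
      3 * L / (128 * 5 ^ n) * R ^ 2 ≤ P.avgRegret A T := by
  let u : ℕ → Euc m := fun t => A.decide (zeroHistory A x t) (x t)
  have huU : ∀ t, u t ∈ U := fun t => A.decide_mem _ _ (hxX t)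
  obtain ⟨C, hdiff, hlip, hzero, ⟨B, hB⟩, hval⟩ := exists_cost hL hR U x u T (hfree u)
  let P : ProblemInstance X U L (L * Metric.diam (jointSet X U)) :=
    { x₀ := x 0
      -- The dynamics ignore the control: the index is recovered from the state and advanced by one.
      F := fun y _ => x (Function.invFunOn x (Set.Iio T) y + 1)
      C := C
      x₀_mem := hxX 0
      F_mem := fun _ _ _ _ => hxX _
      differentiable := hdiff
      grad_lipschitz := hlip
      grad_bound := fun s hs => by
        -- The gradient vanishes at the first query, so the Lipschitz bound also controls its size.
        have h := hlip s (WithLp.toLp 2 (x 0, u 0))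
        rw [(hzero 0 hT).2, sub_zero, ← dist_eq_norm] at h
        refine h.trans ?_
        gcongr
        exact Metric.dist_le_diam_of_mem (isBounded_jointSet hX hU) hs ⟨hxX 0, huU 0⟩ }
  have hrun : ∀ t < T, P.run A t = (zeroHistory A x t, x t) := by
    intro t
    induction t with
    | zero => exact fun _ => rfl
    | succ t ih =>
      intro ht
      have ht' : t < T := by omega
      have hC : P.C (WithLp.toLp 2 (x t, A.decide (zeroHistory A x t) (x t))) = 0 :=
        (hzero t ht').1
      have hG : gradient P.C (WithLp.toLp 2 (x t, A.decide (zeroHistory A x t) (x t))) = 0 :=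
        (hzero t ht').2
      have hinv : Function.invFunOn x (Set.Iio T) (x t) = t := hinj.leftInvOn_invFunOn ht'
      simp only [ProblemInstance.run, ih ht', zeroHistory, hC, hG]
      simp only [P, hinv]
  have hstate : ∀ t < T, P.state A t = x t := fun t ht => by
    rw [ProblemInstance.state, hrun t ht]
  have hquery : ∀ t < T, P.query A t = WithLp.toLp 2 (x t, u t) := fun t ht => by
    rw [ProblemInstance.query, hstate t ht, ProblemInstance.control, hrun t ht]
  refine ⟨P, fun t ht => ⟨hstate t ht, ?_⟩, ?_⟩
  · rw [hquery t ht]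
    exact hzero t ht
  · have hreg : ∀ t ∈ Finset.range T, 3 * L / (128 * 5 ^ n) * R ^ 2 ≤ P.regret A t := by
      intro t ht
      have ht' := Finset.mem_range.1 ht
      obtain ⟨v, hvU, hv⟩ := hval t ht'
      have hinf : sInf ((fun u => P.C (WithLp.toLp 2 (P.state A t, u))) '' U) ≤
          C (WithLp.toLp 2 (x t, v)) := by
        refine csInf_le ⟨B, ?_⟩ ⟨v, hvU, by rw [hstate t ht']⟩
        rintro _ ⟨w, _, rfl⟩
        exact hB _
      have hC : P.C (P.query A t) = 0 := by
        rw [hquery t ht']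
        exact (hzero t ht').1
      rw [ProblemInstance.regret, hC]
      linarith
    have hsum := Finset.card_nsmul_le_sum _ _ _ hreg
    rw [Finset.card_range, nsmul_eq_mul] at hsum
    have hT0 : (0 : ℝ) < T := by exact_mod_cast hT
    rw [ProblemInstance.avgRegret, one_div, ← div_eq_inv_mul, le_div_iff₀ hT0, mul_comm]
    exact hsum

/-! ### Choice of the radius and conclusion -/

theorem dim_pos_of_diam_pos {n : ℕ} {X : Set (Euc n)} (h : 0 < Metric.diam X) : 0 < n := by
  rcases Nat.eq_zero_or_pos n with rfl | hn
  · exact absurd (Metric.diam_subsingleton (Set.subsingleton_of_subsingleton (s := X))) h.ne'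
  · exact hn

/-- The radius `R = c₀ μ T ^ (-1 / (n + m))` balances the number of states that are within `R` of
a given one against the room in a ball of radius `r`. -/
theorem packing_balance {n m : ℕ} (hn : 0 < n) (hm : 0 < m) {D r μ c₀ : ℝ} {T : ℕ} (hT : 0 < T)
    (hD : 0 < D) (hμ : 0 < μ) (hμD : μ ≤ D) (hμr : μ ≤ r)
    (hc₀ : c₀ = 1 / (2 * (1 + 2 * √(n : ℝ)) ^ n)) :
    (1 + 2 * (c₀ * μ * (T : ℝ) ^ (-1 / ((n : ℝ) + m))) /
        (D / (√(n : ℝ) * (T : ℝ) ^ (1 / (n : ℝ))))) ^ n *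
      (c₀ * μ * (T : ℝ) ^ (-1 / ((n : ℝ) + m))) ^ m < r ^ m := by
  have hn0 : (0 : ℝ) < n := by exact_mod_cast hn
  have hm0 : (0 : ℝ) < m := by exact_mod_cast hm
  have hT0 : (0 : ℝ) < T := by exact_mod_cast hT
  have hT1 : (1 : ℝ) ≤ T := by exact_mod_cast hT
  have hr : 0 < r := hμ.trans_le hμr
  set τ := (T : ℝ) ^ (-1 / ((n : ℝ) + m)) with hτ
  set σ := (T : ℝ) ^ (1 / (n : ℝ)) with hσ
  have hτ0 : 0 < τ := Real.rpow_pos_of_pos hT0 _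
  have hσ0 : 0 < σ := Real.rpow_pos_of_pos hT0 _
  have hs0 : 0 < √(n : ℝ) := Real.sqrt_pos.2 hn0
  -- This lets the summand `1` of the packing bound be absorbed into a multiple of `σ * τ`.
  have hprod : 1 ≤ σ * τ := by
    rw [hσ, hτ, ← Real.rpow_add hT0]
    refine Real.one_le_rpow hT1 ?_
    have : 1 / (n : ℝ) + -1 / ((n : ℝ) + m) = m / (n * (n + m)) := by field_simp; ring
    rw [this]; positivity
  have hpow : (σ * τ) ^ n * τ ^ m = 1 := by
    have h1 : σ ^ n = T := by rw [hσ, one_div, Real.rpow_inv_natCast_pow hT0.le hn.ne']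
    have h2 : τ ^ (n + m) = (T : ℝ)⁻¹ := by
      rw [hτ, ← Real.rpow_natCast, ← Real.rpow_mul hT0.le, ← Real.rpow_neg_one]
      congr 1
      push_cast
      field_simp
    rw [mul_pow, mul_assoc, ← pow_add, h1, h2, mul_inv_cancel₀ hT0.ne']
  have hb1 : (1 : ℝ) ≤ (1 + 2 * √(n : ℝ)) ^ n := one_le_pow₀ (by linarith)
  have hc0 : 0 < c₀ := by rw [hc₀]; positivity
  have hc1 : c₀ ≤ 1 := by
    rw [hc₀, div_le_one (by positivity)]; linarith
  have hbase : 1 + 2 * (c₀ * μ * τ) / (D / (√(n : ℝ) * σ)) ≤ (1 + 2 * √(n : ℝ)) * (σ * τ) := by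
    have h1 : 2 * (c₀ * μ * τ) / (D / (√(n : ℝ) * σ)) =
        c₀ * (μ / D) * (2 * √(n : ℝ) * (σ * τ)) := by
      field_simp
    have h2 : c₀ * (μ / D) ≤ 1 := mul_le_one₀ hc1 (by positivity) ((div_le_one hD).2 hμD)
    have h3 : c₀ * (μ / D) * (2 * √(n : ℝ) * (σ * τ)) ≤ 1 * (2 * √(n : ℝ) * (σ * τ)) := by
      gcongr
    rw [h1]
    linarith
  calc (1 + 2 * (c₀ * μ * τ) / (D / (√(n : ℝ) * σ))) ^ n * (c₀ * μ * τ) ^ m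
      ≤ ((1 + 2 * √(n : ℝ)) * (σ * τ)) ^ n * (c₀ * r * τ) ^ m := by gcongr
    _ = (1 + 2 * √(n : ℝ)) ^ n * c₀ ^ m * r ^ m * ((σ * τ) ^ n * τ ^ m) := by
      simp only [mul_pow]; ring
    _ = (1 + 2 * √(n : ℝ)) ^ n * c₀ ^ m * r ^ m := by rw [hpow, mul_one]
    -- As `m > 0` and `c₀ ≤ 1`, one factor `c₀` suffices; it halves the product.
    _ ≤ (1 + 2 * √(n : ℝ)) ^ n * c₀ * r ^ m := by
      gcongr
      exact pow_le_of_le_one hc0.le hc1 hm.ne'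
    _ = 1 / 2 * r ^ m := by rw [hc₀]; field_simp
    _ < r ^ m := by have : 0 < r ^ m := by positivity
                    linarith

theorem mainTheorem2 (n m : ℕ) (L : ℝ) (hL : 0 < L) :
    ∃ ν : ℝ, 0 < ν ∧
      ∀ (X : Set (Euc n)) (U : Set (Euc m)),
        IsCompact X → Convex ℝ X → 0 < Metric.diam X →
        IsCompact U → Convex ℝ U → 0 < Metric.diam U →
        ContainsHypercube X (Metric.diam X / √(n : ℝ)) →
        ∀ (c : Euc m) (r : ℝ), 0 < r → Metric.closedBall c r ⊆ U →
        ∀ T : ℕ, 0 < T → ∀ A : ControlAlgorithm X U,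
          ∃ P : ProblemInstance X U L (L * Metric.diam (jointSet X U)),
            P.IsResisting A (Metric.diam X / (√(n : ℝ) * (T : ℝ) ^ (1 / (n : ℝ)))) T ∧
            ν * min (Metric.diam X) r ^ 2 * (T : ℝ) ^ (-2 / ((n : ℝ) + (m : ℝ)))
              ≤ P.avgRegret A T := by
  obtain ⟨c₀, hc₀⟩ : ∃ c₀ : ℝ, c₀ = 1 / (2 * (1 + 2 * √(n : ℝ)) ^ n) := ⟨_, rfl⟩
  have hc0 : 0 < c₀ := by rw [hc₀]; positivity
  refine ⟨3 * L / (128 * 5 ^ n) * c₀ ^ 2, by positivity, ?_⟩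
  intro X U hX _ hDX hU _ hDU hcube c r hr hball T hT A
  have hn := dim_pos_of_diam_pos hDX
  have hm := dim_pos_of_diam_pos hDU
  have hn0 : (0 : ℝ) < √(n : ℝ) := Real.sqrt_pos.2 (by exact_mod_cast hn)
  have hT0 : (0 : ℝ) < T := by exact_mod_cast hT
  have hμ : 0 < min (Metric.diam X) r := lt_min hDX hr
  obtain ⟨x, hxX, hsep⟩ := hcube.exists_separated hn (div_pos hDX hn0) hT
  rw [div_div] at hsep
  have hbal := packing_balance hn hm hT hDX hμ (min_le_left _ _) (min_le_right _ _) hc₀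
  set ξ := Metric.diam X / (√(n : ℝ) * (T : ℝ) ^ (1 / (n : ℝ)))
  set R := c₀ * min (Metric.diam X) r * (T : ℝ) ^ (-1 / ((n : ℝ) + m)) with hRdef
  have hξ : 0 < ξ := by positivity
  have hR : 0 < R := by positivity
  have hinj : Set.InjOn x (Set.Iio T) := by
    intro i hi j hj hij
    by_contra hne
    have := hsep i hi j hj hne
    rw [hij, sub_self, norm_zero] at this
    exact absurd this (not_lt.2 hξ.le)
  have hfree : ∀ u : ℕ → Euc m, ∀ s < T,
      ∃ v ∈ U, ∀ t < T, dist (x t) (x s) < R → R ≤ dist (u t) v := by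
    intro u s _
    let I := (Finset.range T).filter fun t => dist (x t) (x s) < R
    have hcard : (I.card : ℝ) ≤ (1 + 2 * R / ξ) ^ n := by
      have h := card_le_of_separated_of_dist_le I x (x s) hξ hR
        (fun i hi j hj hij => by
          rw [dist_eq_norm]
          exact (hsep i (Finset.mem_range.1 (Finset.mem_filter.1 hi).1) j
            (Finset.mem_range.1 (Finset.mem_filter.1 hj).1) hij).le)
        fun i hi => (Finset.mem_filter.1 hi).2.le
      rwa [finrank_euclideanSpace_fin] at h
    obtain ⟨v, hv, hvI⟩ := exists_mem_closedBall_forall_le_dist I u c hr hR (by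
      rw [finrank_euclideanSpace_fin]
      exact (mul_le_mul_of_nonneg_right hcard (by positivity)).trans_lt hbal)
    exact ⟨v, hball hv, fun t ht hd =>
      hvI t (Finset.mem_filter.2 ⟨Finset.mem_range.2 ht, hd⟩)⟩
  obtain ⟨P, hP, hreg⟩ := exists_instance hL hR hX hU hT A x hxX hinj hfree
  refine ⟨P, ⟨fun t ht i hi => ?_, fun t ht => (hP t ht).2⟩, ?_⟩
  · rw [(hP (t + 1) ht).1, (hP i (by omega)).1]
    exact hsep _ ht _ (by omega) (by omega)
  · refine le_trans (le_of_eq ?_) hreg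
    have hpow : (T : ℝ) ^ (-2 / ((n : ℝ) + m)) = ((T : ℝ) ^ (-1 / ((n : ℝ) + m))) ^ 2 := by
      rw [← Real.rpow_natCast, ← Real.rpow_mul hT0.le]
      congr 1
      push_cast
      ring
    rw [hpow, hRdef]
    ring
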